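/- **Setting (the FedGAN algorithm).** There are agents $i=1,\dots,B$ with weights $p_i\ge 0$, $\sum_i p_i=1$ (for instance $p_i=|\mathcal R_i|/\sum_j|\mathcal R_j|$ for local data sets $\mathcal R_i$), a synchronization interval $K\ge 1$, and learning rates $a(n),b(n)>0$, $n\ge 0$. Agent $i$ holds a discriminator parameter $w_n^i\in\mathbb R^{d_W}$ and a generator parameter $\theta_n^i\in\mathbb R^{d_\Theta}$, with common initial values $w_0^i=\hat w$, $\theta_0^i=\hat\theta$. At step $n\ge 1$ each agent makes the update $$w_n^i=w_{n-1}^i+a(n-1)\,\tilde g^i(\theta_{n-1}^i,w_{n-1}^i),\qquad \theta_n^i=\theta_{n-1}^i+b(n-1)\,\tilde h^i(\theta_{n-1}^i,w_{n-1}^i),$$ where $\tilde g^i,\tilde h^i$ are stochastic gradients (measurable functions of the parameters and of a random mini-batch $\xi_{n-1}^i$); if $K\mid n$, all $(w_n^i,\theta_n^i)$ are then replaced by their averages $\sum_j p_jw_n^j$, $\sum_j p_j\theta_n^j$. The averaged iterates are $w_n=\sum_i p_iw_n^i$ and $\theta_n=\sum_i p_i\theta_n^i$, $n\ge 0$. The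 stochastic gradients estimate true gradients $g^i(\theta,w)\in\mathbb R^{d_W}$, $h^i(\theta,w)\in\mathbb R^{d_\Theta}$; the pooled true gradients are $g=\sum_ip_ig^i$ and $h=\sum_ip_ih^i$. The aggregated stochastic gradient errors at step $n$ are $$M_n^{(w)}=\sum_i p_i\bigl(g^i(\theta_n^i,w_n^i)-\tilde g^i(\theta_n^i,w_n^i)\bigr),\qquad M_n^{(\theta)}=\sum_i p_i\bigl(h^i(\theta_n^i,w_n^i)-\tilde h^i(\theta_n^i,w_n^i)\bigr),$$ the stochastic gradients being those that the algorithm uses at these parameters. **Assumptions.** - (A1) All $g^i$ and $h^i$ are $L$-Lipschitz. - (A2) $\sum_n a(n)=\sum_n b(n)=\infty$, $\sum_n a(n)^2<\infty$, $\sum_n b(n)^2<\infty$. - (A3) $(M_n^{(\theta)})$ and $(M_n^{(w)})$ are martingale difference sequences with respect to $\mathcal F_n=\sigma(\theta_l,w_l,M_l^{(\theta)},M_l^{(w)};\,l\le n)$: they are integrable and $\mathbb E[M_{n+1}\mid\mathcal F_n]=0$ for all $n\ge 0$. - (A4) Almost surely $\sup_n\|\theta_n\|<\infty$ and $\sup_n\|w_n\|<\infty$.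 - (A5) For all $n$ and $i$, $\mathbb E\|\tilde g^i(\theta_n^i,w_n^i)-g^i(\theta_n^i,w_n^i)\|^2\le\sigma_g^2$ and $\mathbb E\|\tilde h^i(\theta_n^i,w_n^i)-h^i(\theta_n^i,w_n^i)\|^2\le\sigma_h^2$ (bounded variance); and $\|g^i(\theta,w)-g(\theta,w)\|\le\mu_g$ for all $i,\theta,w$ (bounded gradient divergence). - (A6) $b(n)=o(a(n))$. - (A7) There is a Lipschitz map $\lambda:\mathbb R^{d_\Theta}\to\mathbb R^{d_W}$ such that for each $\theta$ the point $\lambda(\theta)$ is a locally asymptotically stable equilibrium of the fast discriminator ODE $\dot w(t)=g(\theta,w(t))$, with domain of attraction $H_\theta$; and $\theta^*$ is a locally asymptotically stable equilibrium of the slow generator ODE $\dot\theta(t)=h(\theta(t),\lambda(\theta(t)))$, with domain of attraction $D^*$. (Locally asymptotically stable means Lyapunov stable and attracting all solutions that start in some neighbourhood; the domain of attraction is the set of all initial points whose solutions converge to the equilibrium.) **Theorem.** Under (A1)–(A7), almost surely on the event that the averaged iterates $(\theta_n,w_n)$ eventually stay in some (possibly sample-dependent) compact subset of the region of attraction $\{(\theta,w):\theta\in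 D^*,\ w\in H_\theta\}$, $$(w_n,\theta_n)\longrightarrow(\lambda(\theta^*),\theta^*)\qquad (n\to\infty).$$ -/

import Mathlib

open MeasureTheory Filter Topology Asymptotics
open scoped NNReal ENNReal

/-- Parameter vectors of dimension `d`, with the Euclidean norm. -/
abbrev Vec (d : ℕ) : Type := EuclideanSpace ℝ (Fin d)

/-! ### Stability of autonomous differential equations -/

section Stability

variable {E : Type*} [NormedAddCommGroup E] [NormedSpace ℝ E]

/-- `x` solves `ẋ(t) = f (x(t))` on `[0, ∞)` with `x(0) = x₀`. -/
def IsForwardSolution (f : E → E) (x₀ : E) (x : ℝ → E) : Prop :=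
  x 0 = x₀ ∧ IsIntegralCurveOn x (fun _ => f) (Set.Ici 0)

/-- The domain of attraction of `e` for `ẋ = f(x)`: the points from which solutions exist for all
positive times and converge to `e`. -/
def domainOfAttraction (f : E → E) (e : E) : Set E :=
  {x₀ | (∃ x, IsForwardSolution f x₀ x) ∧
    ∀ x, IsForwardSolution f x₀ x → Tendsto x atTop (𝓝 e)}

/-- `e` is a locally asymptotically stable equilibrium of `ẋ = f(x)`: an equilibrium that is
Lyapunov stable and attracts all solutions that start in some neighbourhood of it. -/
structure IsLocallyAsymptoticallyStable (f : E → E) (e : E) : Prop where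
  equilibrium : f e = 0
  stable : ∀ ε > 0, ∃ δ > 0, ∀ x₀ x, IsForwardSolution f x₀ x → dist x₀ e < δ →
    ∀ t, 0 ≤ t → dist (x t) e < ε
  attractive : domainOfAttraction f e ∈ 𝓝 e

end Stability

/-! ### Martingale difference sequences -/

/-- `M` is a martingale difference sequence with respect to the increasing `σ`-fields `ℱ n`. -/
structure IsMartingaleDifference {Ω E : Type*} [MeasurableSpace Ω] [NormedAddCommGroup E]
    [NormedSpace ℝ E] [CompleteSpace E] (M : ℕ → Ω → E) (ℱ : ℕ → MeasurableSpace Ω)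
    (μ : Measure Ω) : Prop where
  adapted : ∀ n, StronglyMeasurable[ℱ n] (M n)
  integrable : ∀ n, Integrable (M n) μ
  condExp_succ : ∀ n, μ[M (n + 1) | ℱ n] =ᵐ[μ] 0

/-! ### The algorithm -/

/-- The inputs of the federated algorithm with `B` agents, discriminator parameters `w` of dimension
`dW`, generator parameters `θ` of dimension `dΘ`, and mini-batches in `Ξ`. Pairs of parameters are
written `(θ, w)`. -/
structure FedGAN (B dW dΘ : ℕ) (Ξ : Type*) [MeasurableSpace Ξ] where
  /-- the weights `p i` of the agents -/
  p : Fin B → ℝ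
  p_nonneg : ∀ i, 0 ≤ p i
  p_sum : ∑ i, p i = 1
  /-- the synchronization interval -/
  K : ℕ
  K_pos : 0 < K
  /-- the learning rates of the discriminators -/
  a : ℕ → ℝ
  a_pos : ∀ n, 0 < a n
  /-- the learning rates of the generators -/
  b : ℕ → ℝ
  b_pos : ∀ n, 0 < b n
  /-- the stochastic gradient of agent `i` for the discriminator, on a given mini-batch -/
  gTilde : Fin B → Vec dΘ × Vec dW → Ξ → Vec dW
  gTilde_measurable : ∀ i, Measurable (Function.uncurry (gTilde i))
  /-- the stochastic gradient of agent `i` for the generator, on a given mini-batch -/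
  hTilde : Fin B → Vec dΘ × Vec dW → Ξ → Vec dΘ
  hTilde_measurable : ∀ i, Measurable (Function.uncurry (hTilde i))
  /-- the common initial parameters -/
  init : Vec dΘ × Vec dW

namespace FedGAN

variable {B dW dΘ : ℕ} {Ξ : Type*} [MeasurableSpace Ξ] (A : FedGAN B dW dΘ Ξ)

/-- The weighted average `∑ i, p i • x i` over the agents. -/
def average {E : Type*} [AddCommGroup E] [Module ℝ E] (x : Fin B → E) : E :=
  ∑ i, A.p i • x i

/-- One local stochastic gradient update of agent `i` with the step sizes of index `n`. -/
def localUpdate (n : ℕ) (i : Fin B) (z : Vec dΘ × Vec dW) (s : Ξ) : Vec dΘ × Vec dW :=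
  (z.1 + A.b n • A.hTilde i z s, z.2 + A.a n • A.gTilde i z s)

/-- The parameters `(θ_n^i, w_n^i)` of agent `i` after step `n` (and after the synchronization, when
`K ∣ n`), if agent `j` draws the mini-batch `s m j` at the parameters of index `m`. -/
def agent (s : ℕ → Fin B → Ξ) : ℕ → Fin B → Vec dΘ × Vec dW
  | 0 => fun _ => A.init
  | n + 1 => fun i =>
      if (n + 1) % A.K = 0 then
        A.average fun j => A.localUpdate n j (agent s n j) (s n j)
      else A.localUpdate n i (agent s n i) (s n i)

/-- The averaged parameters `(θ_n, w_n)`. -/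
def averaged (s : ℕ → Fin B → Ξ) (n : ℕ) : Vec dΘ × Vec dW :=
  A.average (A.agent s n)

/-- The true gradient of the pooled problem, `∑ i, p i • f i`, out of those of the agents. -/
def pooled {d : ℕ} (f : Fin B → Vec dΘ × Vec dW → Vec d) (z : Vec dΘ × Vec dW) : Vec d :=
  A.average fun i => f i z

variable {Ω : Type*} (g : Fin B → Vec dΘ × Vec dW → Vec dW) (h : Fin B → Vec dΘ × Vec dW → Vec dΘ)
  (ξ : ℕ → Fin B → Ω → Ξ)

/-- The stochastic gradient error of agent `i` at step `n`, discriminator: `g^i - g̃^i` at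
`(θ_n^i, w_n^i)`. -/
def errorW (n : ℕ) (i : Fin B) (ω : Ω) : Vec dW :=
  g i (A.agent (fun m j => ξ m j ω) n i) -
    A.gTilde i (A.agent (fun m j => ξ m j ω) n i) (ξ n i ω)

/-- The stochastic gradient error of agent `i` at step `n`, generator: `h^i - h̃^i` at
`(θ_n^i, w_n^i)`. -/
def errorΘ (n : ℕ) (i : Fin B) (ω : Ω) : Vec dΘ :=
  h i (A.agent (fun m j => ξ m j ω) n i) -
    A.hTilde i (A.agent (fun m j => ξ m j ω) n i) (ξ n i ω)

/-- The aggregated stochastic gradient error `M_n` of the discriminators. -/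
def noiseW (n : ℕ) (ω : Ω) : Vec dW := A.average fun i => A.errorW g ξ n i ω

/-- The aggregated stochastic gradient error `M_n` of the generators. -/
def noiseΘ (n : ℕ) (ω : Ω) : Vec dΘ := A.average fun i => A.errorΘ h ξ n i ω

/-- The `σ`-field generated by `θ_l`, `w_l` and the two aggregated errors at `l`, for `l ≤ n`. -/
abbrev history (n : ℕ) : MeasurableSpace Ω :=
  ⨆ l ≤ n, MeasurableSpace.comap
    (fun ω => (A.averaged (fun m j => ξ m j ω) l, A.noiseΘ h ξ l ω, A.noiseW g ξ l ω)) inferInstance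

end FedGAN

/-! ### Solutions of Lipschitz differential equations -/

section ODE

variable {E : Type*} [NormedAddCommGroup E] [NormedSpace ℝ E] {f : E → E} {x₀ : E} {x : ℝ → E}

/-! Synchronization does not change the weighted average, so the averaged iterates follow a
two-time-scale Euler scheme for the pooled gradients with two perturbations. The first is the drift,
caused by agents evaluating gradients at their own parameters. It vanishes: agents agree at
multiples of `K`, fewer than `K` local steps separate them from the last agreement, and each step
tends to `0` almost surely (`tendsto_agent_sub_averaged`). The second is the aggregated noise, whose
weighted sums converge almost surely as `L²`-bounded martingales (`ae_cauchySeq_sum_smul`).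

The rest is deterministic and pathwise. The core is `tendsto_sub_equilibrium`. To locate the iterate
at a late index `n`, look back by a bounded time `T`. The scheme was then in the compact set `C`,
the parameter has hardly moved since, and the scheme has tracked an exact solution
(`norm_perturbed_euler_sub_le`). Attraction is uniform on compact sets (`exists_uniform_time`), so
for suitable `T` that solution is now close to the equilibrium.

This is applied twice. In the fast clock the generator is nearly frozen because `b n / a n → 0`,
hence `w_n - lam θ_n → 0`. In the slow clock `w_n` may then be replaced by `lam θ_n` at the cost of
a vanishing error, hence `θ_n → θstar`. -/

theorem IsForwardSolution.shift (h : IsForwardSolution f x₀ x) {s : ℝ} (hs : 0 ≤ s) :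
    IsForwardSolution f (x s) fun t => x (s + t) := by
  refine ⟨by simp, fun t ht => ?_⟩
  have h2 : HasDerivWithinAt (fun t => s + t) 1 (Set.Ici 0) t :=
    ((hasDerivAt_id t).const_add s).hasDerivWithinAt
  have h3 := (h.2 (s + t) (add_nonneg hs ht)).scomp t h2 fun u hu => add_nonneg hs hu
  rw [one_smul] at h3
  exact h3

theorem IsForwardSolution.dist_le {L : ℝ≥0} (hf : LipschitzWith L f)
    (h : IsForwardSolution f x₀ x) {y₀ : E} {y : ℝ → E} (h' : IsForwardSolution f y₀ y)
    {t : ℝ} (ht : 0 ≤ t) : dist (x t) (y t) ≤ dist x₀ y₀ * Real.exp (L * t) := by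
  have := dist_le_of_trajectories_ODE (v := fun _ => f) (K := L) (f := x) (g := y) (a := 0) (b := t)
    (δ := dist x₀ y₀) (fun _ => hf) (h.2.continuousOn.mono Set.Icc_subset_Ici_self)
    (fun s hs => (h.2 s hs.1).mono (Set.Ici_subset_Ici.2 hs.1))
    (h'.2.continuousOn.mono Set.Icc_subset_Ici_self)
    (fun s hs => (h'.2 s hs.1).mono (Set.Ici_subset_Ici.2 hs.1)) (by rw [h.1, h'.1])
    t ⟨ht, le_rfl⟩
  simpa using this

/-- On a compact subset of the domain of attraction, the attraction is uniform. -/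
theorem IsLocallyAsymptoticallyStable.exists_uniform_time {L : ℝ≥0} (hf : LipschitzWith L f) {e : E}
    (he : IsLocallyAsymptoticallyStable f e) {K : Set E} (hK : IsCompact K)
    (hKe : K ⊆ domainOfAttraction f e) {ε : ℝ} (hε : 0 < ε) :
    ∃ T : ℝ, 0 ≤ T ∧ ∀ x₀ ∈ K, ∀ x, IsForwardSolution f x₀ x → ∀ t, T ≤ t → dist (x t) e < ε := by
  obtain ⟨δ, hδ, hstab⟩ := he.stable ε hε
  refine hK.induction_on
    (p := fun s => ∃ T : ℝ, 0 ≤ T ∧ ∀ x₀ ∈ s, ∀ x, IsForwardSolution f x₀ x →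
      ∀ t, T ≤ t → dist (x t) e < ε) ⟨0, le_rfl, by simp⟩ ?_ ?_ ?_
  · rintro s t hst ⟨T, hT, h⟩
    exact ⟨T, hT, fun x₀ hx => h x₀ (hst hx)⟩
  · rintro s t ⟨T, hT, h⟩ ⟨T', -, h'⟩
    refine ⟨max T T', le_max_of_le_left hT, fun x₀ hx x hs u hu => ?_⟩
    rcases hx with hx | hx
    · exact h x₀ hx x hs u ((le_max_left _ _).trans hu)
    · exact h' x₀ hx x hs u ((le_max_right _ _).trans hu)
  · intro v hv
    obtain ⟨⟨y, hy⟩, hlim⟩ := hKe hv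
    obtain ⟨T, hT⟩ := (((Metric.tendsto_nhds.1 (hlim y hy)) (δ / 2) (half_pos hδ)).and
      (eventually_ge_atTop 0)).exists
    have hexp := Real.exp_pos (L * T)
    -- By Grönwall, solutions from this ball are within `δ / 2` of `y` at time `T`, hence within `δ`
    -- of `e`. Lyapunov stability, applied to the solution restarted at `T`, controls all later
    -- times.
    refine ⟨Metric.ball v (δ / 2 / Real.exp (L * T)),
      mem_nhdsWithin_of_mem_nhds (Metric.ball_mem_nhds _ (by positivity)), T, hT.2, ?_⟩
    intro x₀ hx₀ x hx t ht
    have h1 : dist (x T) (y T) < δ / 2 :=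
      (hx.dist_le hf hy hT.2).trans_lt ((lt_div_iff₀ hexp).1 hx₀)
    have h2 : dist (x T) e < δ := by
      linarith [dist_triangle (x T) (y T) e, hT.1]
    simpa using hstab _ _ (hx.shift hT.2) h2 (t - T) (sub_nonneg.2 ht)

/-- Local truncation error: the speed is at most `M`, so `x` moves by at most `M * a` during the
step and its velocity changes by at most `L * M * a`. -/
theorem IsForwardSolution.norm_euler_step_le {L : ℝ≥0} (hf : LipschitzWith L f)
    (h : IsForwardSolution f x₀ x) {S M : ℝ} (hM : ∀ t ∈ Set.Icc 0 S, ‖f (x t)‖ ≤ M) {s a : ℝ}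
    (hs : 0 ≤ s) (ha : 0 ≤ a) (hsa : s + a ≤ S) :
    ‖x (s + a) - x s - a • f (x s)‖ ≤ L * M * a ^ 2 := by
  have hM0 : 0 ≤ M := (norm_nonneg _).trans (hM s ⟨hs, by linarith⟩)
  have hsub : Set.Icc s (s + a) ⊆ Set.Ici 0 := fun t ht => hs.trans ht.1
  have h1 : ∀ t ∈ Set.Icc s (s + a), ‖x t - x s‖ ≤ M * a := fun t ht => by
    have := (convex_Icc s (s + a)).norm_image_sub_le_of_norm_hasDerivWithin_le (f := x)
      (fun u hu => (h.2 u (hsub hu)).mono hsub)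
      (fun u hu => hM u ⟨hsub hu, hu.2.trans hsa⟩) ⟨le_rfl, by linarith⟩ ht
    refine this.trans (mul_le_mul_of_nonneg_left ?_ hM0)
    rw [Real.norm_of_nonneg (by linarith [ht.1])]
    linarith [ht.2]
  have h2 : ∀ t ∈ Set.Icc s (s + a), HasDerivWithinAt (fun t => x t - (t - s) • f (x s))
      (f (x t) - f (x s)) (Set.Icc s (s + a)) t := fun t ht => by
    have := ((h.2 t (hsub ht)).mono hsub).sub
      ((((hasDerivAt_id t).sub_const s).smul_const (f (x s))).hasDerivWithinAt)
    rw [one_smul] at this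
    exact this
  have h3 := (convex_Icc s (s + a)).norm_image_sub_le_of_norm_hasDerivWithin_le
      (C := L * (M * a)) h2
      (fun u hu => (hf.norm_sub_le _ _).trans (mul_le_mul_of_nonneg_left (h1 u hu) L.2))
      (x := s) (y := s + a) ⟨le_rfl, by linarith⟩ ⟨by linarith, le_rfl⟩
  have h4 : x (s + a) - x s - a • f (x s)
      = x (s + a) - (s + a - s) • f (x s) - (x s - (s - s) • f (x s)) := by
    simp only [add_sub_cancel_left, sub_self, zero_smul]; abel
  rw [h4]
  refine h3.trans (le_of_eq ?_)
  rw [add_sub_cancel_left, Real.norm_of_nonneg ha]; ring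

/-- A perturbed Euler scheme stays close to an exact solution over a bounded time window. -/
theorem IsForwardSolution.norm_perturbed_euler_sub_le {L : ℝ≥0} (hf : LipschitzWith L f)
    (h : IsForwardSolution f x₀ x) {S M : ℝ} (hM : ∀ t ∈ Set.Icc 0 S, ‖f (x t)‖ ≤ M)
    {a t : ℕ → ℝ} (ha : ∀ n, 0 ≤ a n) (ht : ∀ n, t (n + 1) = t n + a n) {z ρ U : ℕ → E}
    (hz : ∀ n, z (n + 1) = z n + a n • (f (z n) + ρ n) + (U (n + 1) - U n)) {m n : ℕ} {η : ℝ}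
    (hmn : m ≤ n) (hS : t n - t m ≤ S) (haη : ∀ k, m ≤ k → a k ≤ η)
    (hρ : ∀ k, m ≤ k → k < n → ‖ρ k‖ ≤ η) (hU : ∀ k, m ≤ k → ‖U k - U m‖ ≤ η)
    (h0 : ‖z m - x₀‖ ≤ η) :
    ‖z n - x (t n - t m)‖ ≤ (Real.exp (L * S) * (1 + S * (L * M + L + 1)) + 1) * η := by
  have htm : Monotone t := monotone_nat_of_le_succ fun n => by rw [ht]; linarith [ha n]
  have hS0 : 0 ≤ S := (sub_nonneg.2 (htm hmn)).trans hS
  have hM0 : 0 ≤ M := (norm_nonneg _).trans (hM 0 ⟨le_rfl, hS0⟩)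
  have hη : 0 ≤ η := (norm_nonneg _).trans h0
  have hL : (0 : ℝ) ≤ L := L.2
  -- Errors per unit of time, in multiples of `η`: truncation gives `L * M`, evaluating `f` at a
  -- point displaced by `U k - U m` gives `L`, and `ρ` gives `1`.
  set κ : ℝ := L * M + L + 1 with hκ
  have hκ0 : 0 ≤ κ := by positivity
  -- Discrete Grönwall. Removing `U k - U m` first is essential: only net increments of `U` are
  -- small, not the sum of their norms.
  have key : ∀ k, m ≤ k → k ≤ n → ‖z k - (U k - U m) - x (t k - t m)‖ ≤
      Real.exp (L * (t k - t m)) * (η + (t k - t m) * (κ * η)) := by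
    intro k hk
    induction k, hk using Nat.le_induction with
    | base => intro _; simpa [h.1] using h0
    | succ k hk ih =>
      intro hkn
      have ih := ih (by omega)
      have hτ : 0 ≤ t k - t m := sub_nonneg.2 (htm hk)
      have hτ' : t k - t m + a k ≤ S := by
        have := htm hkn; rw [ht] at this; linarith
      set τ := t k - t m with hτd
      have e1 : t (k + 1) - t m = τ + a k := by rw [ht]; ring
      rw [e1]
      set D := z k - (U k - U m) - x τ with hD
      have hstep := h.norm_euler_step_le hf hM hτ (ha k) hτ'
      have e2 : z (k + 1) - (U (k + 1) - U m) - x (τ + a k) = D + a k • (f (z k) - f (x τ))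
          + a k • ρ k - (x (τ + a k) - x τ - a k • f (x τ)) := by
        rw [hz, hD, smul_add, smul_sub]; abel
      have h5 : ‖f (z k) - f (x τ)‖ ≤ L * (‖D‖ + η) := by
        refine (hf.norm_sub_le _ _).trans (mul_le_mul_of_nonneg_left ?_ hL)
        have : z k - x τ = D + (U k - U m) := by rw [hD]; abel
        rw [this]
        exact (norm_add_le _ _).trans (by linarith [hU k hk])
      have h6 : ‖z (k + 1) - (U (k + 1) - U m) - x (τ + a k)‖ ≤
          ‖D‖ + a k * (L * (‖D‖ + η)) + a k * η + L * M * a k ^ 2 := by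
        rw [e2]
        refine (norm_sub_le _ _).trans (add_le_add ((norm_add_le _ _).trans (add_le_add
          ((norm_add_le _ _).trans (add_le_add le_rfl ?_)) ?_)) hstep)
        · rw [norm_smul, Real.norm_of_nonneg (ha k)]
          exact mul_le_mul_of_nonneg_left h5 (ha k)
        · rw [norm_smul, Real.norm_of_nonneg (ha k)]
          exact mul_le_mul_of_nonneg_left (hρ k hk (by omega)) (ha k)
      have h7 : L * M * a k ^ 2 ≤ a k * (L * M * η) := by
        have := mul_le_mul_of_nonneg_left (haη k hk) (mul_nonneg (mul_nonneg hL hM0) (ha k))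
        nlinarith
      have h8 : ‖z (k + 1) - (U (k + 1) - U m) - x (τ + a k)‖ ≤
          (L * a k + 1) * ‖D‖ + a k * (κ * η) := by
        rw [hκ]; linarith
      have h9 : L * a k + 1 ≤ Real.exp (L * a k) := Real.add_one_le_exp _
      have h10 : 1 ≤ Real.exp (L * (τ + a k)) :=
        Real.one_le_exp (mul_nonneg hL (add_nonneg hτ (ha k)))
      calc _ ≤ _ := h8
        _ ≤ Real.exp (L * a k) * (Real.exp (L * τ) * (η + τ * (κ * η)))
            + Real.exp (L * (τ + a k)) * (a k * (κ * η)) := by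
          refine add_le_add (mul_le_mul h9 ih (norm_nonneg _) (Real.exp_pos _).le) ?_
          exact le_mul_of_one_le_left (mul_nonneg (ha k) (mul_nonneg hκ0 hη)) h10
        _ = _ := by rw [mul_add (L : ℝ), Real.exp_add]; ring
  have hτ : 0 ≤ t n - t m := sub_nonneg.2 (htm hmn)
  have e3 : z n - x (t n - t m) = (z n - (U n - U m) - x (t n - t m)) + (U n - U m) := by abel
  rw [e3]
  refine (norm_add_le _ _).trans ((add_le_add (key n hmn le_rfl) (hU n hmn)).trans ?_)
  have h11 : Real.exp (L * (t n - t m)) ≤ Real.exp (L * S) :=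
    Real.exp_le_exp.2 (mul_le_mul_of_nonneg_left hS hL)
  have h12 : η + (t n - t m) * (κ * η) ≤ η + S * (κ * η) := by gcongr
  have := mul_le_mul h11 h12 (by positivity) (Real.exp_pos _).le
  calc _ ≤ Real.exp (L * S) * (η + S * (κ * η)) + η := by linarith
    _ = _ := by ring

end ODE

/-! ### Stochastic approximation with slowly varying parameters -/

section Approximation

/-- Time windows of length about `T` that end at `t n` and escape to infinity. -/
theorem exists_time_windows {a t : ℕ → ℝ} (ht : ∀ n, t (n + 1) = t n + a n)
    (ht' : Tendsto t atTop atTop) (ha : Tendsto a atTop (𝓝 0)) {T : ℝ} (hT : 0 ≤ T) :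
    ∃ m : ℕ → ℕ, Tendsto m atTop atTop ∧
      ∀ᶠ n in atTop, m n ≤ n ∧ T ≤ t n - t (m n) ∧ t n - t (m n) ≤ T + 1 := by
  classical
  -- The window starts at the last index at least `T` before `t n`. The next index is less than `T`
  -- before it, so steps below `1` keep the length at most `T + 1`.
  have hm : Tendsto (fun n => Nat.findGreatest (fun k => t k ≤ t n - T) n) atTop atTop := by
    refine tendsto_atTop.2 fun N => ?_
    filter_upwards [eventually_ge_atTop N, tendsto_atTop.1 ht' (t N + T)] with n hn hn'
    exact Nat.le_findGreatest hn (by linarith)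
  refine ⟨_, hm, ?_⟩
  have ha1 : ∀ᶠ n in atTop, a n < 1 := ha.eventually_lt_const one_pos
  -- Once `t 0 + T ≤ t n`, index `0` qualifies, so `Nat.findGreatest` returns a genuine witness
  -- rather than its default `0`.
  filter_upwards [tendsto_atTop.1 ht' (t 0 + T), hm.eventually ha1] with n hn hn1
  have hle := Nat.findGreatest_le (P := fun k => t k ≤ t n - T) n
  have hspec := Nat.findGreatest_spec (P := fun k => t k ≤ t n - T) (Nat.zero_le n) (by linarith)
  generalize hk : Nat.findGreatest (fun k => t k ≤ t n - T) n = k at *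
  refine ⟨hle, by linarith, ?_⟩
  rcases hle.eq_or_lt with h | h
  · rw [h]; linarith
  · have := Nat.findGreatest_is_greatest (P := fun k => t k ≤ t n - T) (n := n) (k := k + 1)
      (by omega) h
    rw [ht] at this
    linarith

variable {P W : Type*} [NormedAddCommGroup P] [NormedSpace ℝ P] [NormedAddCommGroup W]
  [NormedSpace ℝ W]

/-- This freezes the parameter over a window of bounded length: the steps sum to `t k - t m`, and
the increment of `V` costs one more `η`. -/
theorem norm_sub_le_of_slow_recursion {a t : ℕ → ℝ} (ha : ∀ n, 0 ≤ a n)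
    (ht : ∀ n, t (n + 1) = t n + a n) {p q V : ℕ → P}
    (hp : ∀ n, p (n + 1) = p n + a n • q n + (V (n + 1) - V n)) {m : ℕ} {η : ℝ}
    (hq : ∀ k, m ≤ k → ‖q k‖ ≤ η) (hV : ∀ k, m ≤ k → ‖V k - V m‖ ≤ η) {k : ℕ} (hk : m ≤ k) :
    ‖p k - p m‖ ≤ (t k - t m + 1) * η := by
  have key : ‖p k - (V k - V m) - p m‖ ≤ (t k - t m) * η := by
    induction k, hk using Nat.le_induction with
    | base => simp
    | succ k hk ih =>
      have : p (k + 1) - (V (k + 1) - V m) - p m = (p k - (V k - V m) - p m) + a k • q k := by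
        rw [hp]; abel
      rw [this, ht]
      refine (norm_add_le _ _).trans ?_
      rw [norm_smul, Real.norm_of_nonneg (ha k)]
      have := mul_le_mul_of_nonneg_left (hq k hk) (ha k)
      linarith
  have : p k - p m = (p k - (V k - V m) - p m) + (V k - V m) := by abel
  rw [this]
  refine (norm_add_le _ _).trans ?_
  linarith [hV k hk]

/-- A stochastic approximation scheme for `ẋ = F (p, x)` with slowly varying `p` that stays in a
compact part of the region of attraction follows the equilibrium `e p`. -/
theorem tendsto_sub_equilibrium {F : P → W → W} {L : ℝ≥0} (hF : ∀ p, LipschitzWith L (F p))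
    (hF' : ∀ x, LipschitzWith L fun p => F p x) {e : P → W} (he : Continuous e)
    (hst : ∀ p, IsLocallyAsymptoticallyStable (F p) (e p)) {C : Set (P × W)} (hC : IsCompact C)
    (hCd : ∀ z ∈ C, z.2 ∈ domainOfAttraction (F z.1) (e z.1)) {a : ℕ → ℝ} (ha : ∀ n, 0 ≤ a n)
    (ha0 : Tendsto a atTop (𝓝 0))
    (hsum : Tendsto (fun N => ∑ n ∈ Finset.range N, a n) atTop atTop) {x r U : ℕ → W}
    {p q V : ℕ → P}
    (hx : ∀ n, x (n + 1) = x n + a n • (F (p n) (x n) + r n) + (U (n + 1) - U n))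
    (hp : ∀ n, p (n + 1) = p n + a n • q n + (V (n + 1) - V n))
    (hr : Tendsto r atTop (𝓝 0)) (hq : Tendsto q atTop (𝓝 0)) (hU : CauchySeq U)
    (hV : CauchySeq V) (hmem : ∀ᶠ n in atTop, (p n, x n) ∈ C) :
    Tendsto (fun n => x n - e (p n)) atTop (𝓝 0) := by
  set t : ℕ → ℝ := fun N => ∑ n ∈ Finset.range N, a n with htd
  have ht : ∀ n, t (n + 1) = t n + a n := fun n => Finset.sum_range_succ _ _
  have htails : ∀ η > 0, ∃ N, ∀ m, N ≤ m → (∀ k, m ≤ k → a k ≤ η) ∧ (∀ k, m ≤ k → ‖r k‖ ≤ η) ∧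
      (∀ k, m ≤ k → ‖q k‖ ≤ η) ∧ (∀ k, m ≤ k → ‖U k - U m‖ ≤ η) ∧
      ∀ k, m ≤ k → ‖V k - V m‖ ≤ η := by
    intro η hη
    have h1 : ∀ᶠ k in atTop, a k ≤ η := ha0.eventually_le_const hη
    have h2 : ∀ᶠ k in atTop, ‖r k‖ ≤ η :=
      (tendsto_zero_iff_norm_tendsto_zero.1 hr).eventually_le_const hη
    have h3 : ∀ᶠ k in atTop, ‖q k‖ ≤ η :=
      (tendsto_zero_iff_norm_tendsto_zero.1 hq).eventually_le_const hη
    obtain ⟨N, hN⟩ := eventually_atTop.1 (h1.and (h2.and h3))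
    obtain ⟨N₁, hN₁⟩ := Metric.cauchySeq_iff.1 hU η hη
    obtain ⟨N₂, hN₂⟩ := Metric.cauchySeq_iff.1 hV η hη
    refine ⟨max N (max N₁ N₂), fun m hm => ?_⟩
    simp only [max_le_iff] at hm
    refine ⟨fun k hk => (hN k (by omega)).1, fun k hk => (hN k (by omega)).2.1,
      fun k hk => (hN k (by omega)).2.2, fun k hk => ?_, fun k hk => ?_⟩
    · rw [← dist_eq_norm]; exact (hN₁ k (by omega) m (by omega)).le
    · rw [← dist_eq_norm]; exact (hN₂ k (by omega) m (by omega)).le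
  -- Along an ultrafilter, compactness of `C` gives limits at both ends of the window without
  -- extracting subsequences.
  rw [tendsto_iff_ultrafilter]
  intro 𝒰 h𝒰
  obtain ⟨⟨p₀, x₀⟩, -, hz₀⟩ := hC.ultrafilter_le_nhds (𝒰.map fun n => (p n, x n))
    (le_principal_iff.2 (h𝒰 hmem))
  replace hz₀ : Tendsto (fun n => (p n, x n)) 𝒰 (𝓝 (p₀, x₀)) := hz₀
  have hp₀ : Tendsto p 𝒰 (𝓝 p₀) := (continuous_fst.tendsto _).comp hz₀
  suffices hlim : Tendsto x 𝒰 (𝓝 (e p₀)) by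
    simpa using hlim.sub ((he.tendsto p₀).comp hp₀)
  refine Metric.tendsto_nhds.2 fun ε hε => ?_
  -- `T` must be fixed before the windows, hence before the limit `p₁` of the parameters at their
  -- starts is known. So it is chosen for the slice of `C` over `p₀`, and `p₁ = p₀` is shown
  -- afterwards.
  have hK : IsCompact ((fun x => (p₀, x)) ⁻¹' C) :=
    (hC.image continuous_snd).of_isClosed_subset (hC.isClosed.preimage (by fun_prop))
      fun x hx => ⟨_, hx, rfl⟩
  obtain ⟨T, hT0, hT⟩ := (hst p₀).exists_uniform_time (hF p₀) hK (fun x hx => hCd _ hx)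
    (half_pos hε)
  obtain ⟨m, hm, hmt⟩ := exists_time_windows ht hsum ha0 hT0
  have hm𝒰 : Tendsto m 𝒰 atTop := hm.mono_left h𝒰
  have hmt𝒰 := h𝒰 hmt
  obtain ⟨⟨p₁, x₁⟩, hz₁C, hz₁⟩ := hC.ultrafilter_le_nhds (𝒰.map fun n => (p (m n), x (m n)))
    (le_principal_iff.2 (hm𝒰.eventually hmem))
  replace hz₁ : Tendsto (fun n => (p (m n), x (m n))) 𝒰 (𝓝 (p₁, x₁)) := hz₁
  have hp₁ : Tendsto (fun n => p (m n)) 𝒰 (𝓝 p₁) := (continuous_fst.tendsto _).comp hz₁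
  have hx₁ : Tendsto (fun n => x (m n)) 𝒰 (𝓝 x₁) := (continuous_snd.tendsto _).comp hz₁
  have hslow : ∀ η > 0, ∀ᶠ n in (𝒰 : Filter ℕ), ∀ k, m n ≤ k → k ≤ n →
      ‖p k - p (m n)‖ ≤ (T + 2) * η := by
    intro η hη
    obtain ⟨N, hN⟩ := htails η hη
    filter_upwards [hmt𝒰, hm𝒰.eventually (eventually_ge_atTop N)] with n hn hnN k hk hkn
    obtain ⟨-, -, h3, -, h5⟩ := hN _ hnN
    refine (norm_sub_le_of_slow_recursion ha ht hp h3 h5 hk).trans ?_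
    have htm : Monotone t := monotone_nat_of_le_succ fun n => by rw [ht]; linarith [ha n]
    have := htm hkn
    exact mul_le_mul_of_nonneg_right (by linarith [hn.2.2]) hη.le
  obtain rfl : p₁ = p₀ := by
    refine eq_of_forall_dist_le fun ε hε => ?_
    have h1 := hslow (ε / (T + 2)) (by positivity)
    refine le_of_tendsto (hp₁.dist hp₀) ?_
    filter_upwards [h1, hmt𝒰] with n hn hn'
    rw [dist_comm, dist_eq_norm]
    refine (hn n hn'.1 le_rfl).trans (le_of_eq ?_)
    field_simp
  obtain ⟨⟨y, hy⟩, -⟩ := hCd _ hz₁C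
  obtain ⟨M, hM⟩ := (isCompact_Icc (a := (0 : ℝ)) (b := T + 1)).exists_bound_of_continuousOn
    (f := fun s => F p₁ (y s))
    ((hF p₁).continuous.comp_continuousOn (hy.2.continuousOn.mono Set.Icc_subset_Ici_self))
  have hM0 : 0 ≤ M := (norm_nonneg _).trans (hM 0 ⟨le_rfl, by linarith⟩)
  set κ : ℝ := Real.exp (L * (T + 1)) * (1 + (T + 1) * (L * M + L + 1)) + 1
  have hκ : 0 < κ := by positivity
  set η : ℝ := ε / (2 * κ) with hη
  have hη0 : 0 < η := by positivity
  have hD : 1 ≤ L * (T + 3) + 1 := le_add_of_nonneg_left (by positivity)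
  -- Inside the window `p k` is within `(T + 2) * η'` of `p (m n)`, which is within `η'` of `p₁`.
  -- Freezing the parameter at `p₁` thus costs `L * (T + 3) * η'`, and `r` costs `η'`; together they
  -- make `η`.
  set η' : ℝ := η / (L * (T + 3) + 1) with hη'
  have hη'0 : 0 < η' := by positivity
  have hη'le : η' ≤ η := div_le_self hη0.le hD
  have hη'eq : L * (T + 2) * η' + L * η' + η' = η := by
    rw [hη']; field_simp; ring
  obtain ⟨N, hN⟩ := htails η' hη'0
  filter_upwards [hmt𝒰, hm𝒰.eventually (eventually_ge_atTop N), hslow η' hη'0,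
    Metric.tendsto_nhds.1 hp₁ η' hη'0, Metric.tendsto_nhds.1 hx₁ η' hη'0]
    with n hn hnN hns hnp hnx
  obtain ⟨h1, h2, h3, h4, h5⟩ := hN _ hnN
  have hmain := hy.norm_perturbed_euler_sub_le (hF p₁) hM ha ht
    (z := x) (ρ := fun k => F (p k) (x k) - F p₁ (x k) + r k) (U := U) (m := m n) (n := n) (η := η)
    (fun n => by rw [hx]; congr 3; abel) hn.1 hn.2.2 (fun k hk => (h1 k hk).trans hη'le)
    (fun k hk hkn => by
      have e1 : ‖F (p k) (x k) - F p₁ (x k)‖ ≤ L * ‖p k - p₁‖ := (hF' (x k)).norm_sub_le _ _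
      have e2 : ‖p k - p₁‖ ≤ (T + 2) * η' + η' := by
        rw [dist_eq_norm] at hnp
        exact (norm_sub_le_norm_sub_add_norm_sub _ (p (m n)) _).trans
          (add_le_add (hns k hk hkn.le) hnp.le)
      have e3 := mul_le_mul_of_nonneg_left e2 L.2
      refine (norm_add_le _ _).trans ?_
      have := h2 k hk
      simp only [NNReal.val_eq_coe] at e3
      linarith)
    (fun k hk => (h4 k hk).trans hη'le) (by rw [← dist_eq_norm]; exact hnx.le.trans hη'le)
  have h6 := hT x₁ hz₁C y hy _ hn.2.1
  have h7 : κ * η = ε / 2 := by rw [hη]; field_simp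
  rw [h7, ← dist_eq_norm] at hmain
  linarith [dist_triangle (x n) (y (t n - t (m n))) (e p₁)]

end Approximation

/-! ### Convergence of weighted sums of martingale differences -/

section Noise

variable {Ω : Type*} {m0 : MeasurableSpace Ω} {μ : Measure Ω}

/-- Each increment is orthogonal to the preceding partial sum, so second moments add up and stay
below `s * ∑' k, c k ^ 2`. The `L¹`-bounded martingale convergence theorem applies. -/
theorem ae_exists_tendsto_sum_mul [IsProbabilityMeasure μ] {ℱ : Filtration ℕ m0}
    {X : ℕ → Ω → ℝ} (hX : StronglyAdapted ℱ X) (hX2 : ∀ n, MemLp (X n) 2 μ)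
    (hcond : ∀ n, μ[X (n + 1) | ℱ n] =ᵐ[μ] 0) {c : ℕ → ℝ} {s : ℝ}
    (hs : ∀ n, ∫ ω, X n ω ^ 2 ∂μ ≤ s) (hc : Summable fun n => c n ^ 2) :
    ∀ᵐ ω ∂μ, ∃ l, Tendsto (fun n => ∑ k ∈ Finset.range (n + 1), c k * X k ω) atTop (𝓝 l) := by
  set S : ℕ → Ω → ℝ := fun n ω => ∑ k ∈ Finset.range (n + 1), c k * X k ω with hS
  have hSsucc : ∀ n ω, S (n + 1) ω = S n ω + c (n + 1) * X (n + 1) ω :=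
    fun n ω => Finset.sum_range_succ _ _
  have hSadp : StronglyAdapted ℱ S := fun n =>
    Finset.stronglyMeasurable_fun_sum _ fun k hk =>
      ((hX k).mono (ℱ.mono (by simpa [Nat.lt_succ_iff] using hk))).const_mul _
  have hS2 : ∀ n, MemLp (S n) 2 μ := fun n => memLp_finsetSum _ fun k _ => (hX2 k).const_mul _
  have hs0 : 0 ≤ s := (integral_nonneg fun ω => sq_nonneg (X 0 ω)).trans (hs 0)
  have horth : ∀ n, ∫ ω, S n ω * X (n + 1) ω ∂μ = 0 := fun n => by
    have hint : Integrable (S n * X (n + 1)) μ := (hS2 n).integrable_mul (hX2 (n + 1))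
    have h1 := condExp_mul_of_stronglyMeasurable_left (m := ℱ n) (hSadp n) hint
      ((hX2 (n + 1)).integrable (by norm_num))
    have h2 : μ[S n * X (n + 1) | ℱ n] =ᵐ[μ] 0 := by
      filter_upwards [h1, hcond n] with ω h h'
      rw [h, Pi.mul_apply, h']; simp
    have h3 := integral_condExp (μ := μ) (f := S n * X (n + 1)) (ℱ.le n)
    rw [integral_congr_ae h2] at h3
    simpa using h3.symm
  have hbd : ∀ n, ∫ ω, S n ω ^ 2 ∂μ ≤ s * ∑ k ∈ Finset.range (n + 1), c k ^ 2 := by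
    intro n
    induction n with
    | zero =>
      have := mul_le_mul_of_nonneg_left (hs 0) (sq_nonneg (c 0))
      simp only [hS, zero_add, Finset.range_one, Finset.sum_singleton, mul_pow,
        integral_const_mul]
      linarith
    | succ n ih =>
      have e : ∀ ω, S (n + 1) ω ^ 2 = S n ω ^ 2 + (2 * c (n + 1)) * (S n ω * X (n + 1) ω)
          + c (n + 1) ^ 2 * X (n + 1) ω ^ 2 := fun ω => by rw [hSsucc]; ring
      have i1 : Integrable (fun ω => S n ω ^ 2) μ := (hS2 n).integrable_sq
      have i2 : Integrable (fun ω => (2 * c (n + 1)) * (S n ω * X (n + 1) ω)) μ :=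
        ((hS2 n).integrable_mul (hX2 (n + 1))).const_mul _
      have i3 : Integrable (fun ω => c (n + 1) ^ 2 * X (n + 1) ω ^ 2) μ :=
        (hX2 (n + 1)).integrable_sq.const_mul _
      have i12 : Integrable (fun ω => S n ω ^ 2 + 2 * c (n + 1) * (S n ω * X (n + 1) ω)) μ :=
        i1.add i2
      simp_rw [e]
      rw [integral_add i12 i3, integral_add i1 i2, integral_const_mul, integral_const_mul,
        horth, Finset.sum_range_succ]
      have := mul_le_mul_of_nonneg_left (hs (n + 1)) (sq_nonneg (c (n + 1)))
      linarith
  have hmart : Martingale S ℱ μ := by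
    refine martingale_of_condExp_sub_eq_zero_nat hSadp (fun n => (hS2 n).integrable (by norm_num))
      fun n => ?_
    have : S (n + 1) - S n = c (n + 1) • X (n + 1) := by
      ext ω; simp [hSsucc]
    rw [this]
    filter_upwards [condExp_smul (μ := μ) (c (n + 1)) (X (n + 1)) (ℱ n), hcond n] with ω h h'
    rw [h, Pi.smul_apply, h']; simp
  refine hmart.submartingale.exists_ae_tendsto_of_bdd (R := (1 + s * ∑' k, c k ^ 2).toNNReal)
    fun n => ?_
  have hi : Integrable (S n) μ := (hS2 n).integrable (by norm_num)
  rw [eLpNorm_one_eq_lintegral_enorm, ← ofReal_integral_norm_eq_lintegral_enorm hi]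
  refine ENNReal.ofReal_le_ofReal ?_
  calc ∫ ω, ‖S n ω‖ ∂μ ≤ ∫ ω, (1 + S n ω ^ 2) ∂μ := by
        refine integral_mono hi.norm ((integrable_const _).add (hS2 n).integrable_sq) fun ω => ?_
        simp only [Real.norm_eq_abs]
        nlinarith [sq_abs (S n ω), sq_nonneg (|S n ω| - 1), abs_nonneg (S n ω)]
    _ = 1 + ∫ ω, S n ω ^ 2 ∂μ := by
        rw [integral_add (integrable_const _) (hS2 n).integrable_sq]; simp
    _ ≤ _ := by
        have := mul_le_mul_of_nonneg_left
          (hc.sum_le_tsum (Finset.range (n + 1)) fun k _ => sq_nonneg _) hs0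
        linarith [hbd n]

/-- A series of martingale differences that are bounded in `L²`, with square summable weights,
converges almost surely. -/
theorem IsMartingaleDifference.ae_cauchySeq_sum_smul [IsProbabilityMeasure μ] {d : ℕ}
    {M : ℕ → Ω → Vec d} {ℱ : Filtration ℕ m0} (hM : IsMartingaleDifference M ℱ μ) {σ : ℝ}
    (hσ : ∀ n, ∫⁻ ω, ‖M n ω‖ₑ ^ 2 ∂μ ≤ ENNReal.ofReal (σ ^ 2)) {c : ℕ → ℝ}
    (hc : Summable fun n => c n ^ 2) :
    ∀ᵐ ω ∂μ, CauchySeq fun n => ∑ k ∈ Finset.range n, c k • M k ω := by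
  have hcoord : ∀ (i : Fin d) n (ω : Ω), ‖M n ω i‖ ≤ ‖M n ω‖ := fun i n ω =>
    PiLp.norm_apply_le (M n ω) i
  have hM2 : ∀ n, MemLp (M n) 2 μ := fun n => by
    refine ⟨(hM.integrable n).aestronglyMeasurable, ?_⟩
    rw [eLpNorm_lt_top_iff_lintegral_rpow_enorm_lt_top (by norm_num) (by norm_num)]
    simpa using (hσ n).trans_lt ENNReal.ofReal_lt_top
  have hsq : ∀ n, ∫ ω, ‖M n ω‖ ^ 2 ∂μ ≤ σ ^ 2 := fun n => by
    rw [integral_eq_lintegral_of_nonneg_ae (ae_of_all _ fun ω => sq_nonneg _)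
      ((hM2 n).aestronglyMeasurable.norm.pow 2)]
    refine ENNReal.toReal_le_of_le_ofReal (sq_nonneg σ) (le_trans (le_of_eq ?_) (hσ n))
    refine lintegral_congr fun ω => ?_
    rw [ENNReal.ofReal_pow (norm_nonneg _), ofReal_norm]
  have hadp : ∀ i : Fin d, StronglyAdapted ℱ fun n ω => M n ω i := fun i n =>
    (EuclideanSpace.proj (𝕜 := ℝ) i).continuous.comp_stronglyMeasurable (hM.adapted n)
  have hL2 : ∀ (i : Fin d) n, MemLp (fun ω => M n ω i) 2 μ := fun i n =>
    (hM2 n).mono (((hadp i n).mono (ℱ.le n)).aestronglyMeasurable)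
      (ae_of_all _ fun ω => hcoord i n ω)
  have h : ∀ i : Fin d, ∀ᵐ ω ∂μ, ∃ l, Tendsto
      (fun n => ∑ k ∈ Finset.range (n + 1), c k * M k ω i) atTop (𝓝 l) := fun i => by
    refine ae_exists_tendsto_sum_mul (hadp i) (hL2 i) (fun n => ?_) (s := σ ^ 2) (fun n => ?_) hc
    · have := (EuclideanSpace.proj (𝕜 := ℝ) i : Vec d →L[ℝ] ℝ).comp_condExp_comm (m := ℱ n)
        (hM.integrable (n + 1))
      filter_upwards [this, hM.condExp_succ n] with ω h1 h2
      have h3 : (μ[fun ω => M (n + 1) ω i | ℱ n]) ω = (μ[M (n + 1) | ℱ n]) ω i := h1.symm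
      rw [h3, h2]; simp
    · refine (integral_mono (hL2 i n).integrable_sq ((hM2 n).integrable_norm_pow (by norm_num))
        fun ω => ?_).trans (hsq n)
      simpa using pow_le_pow_left₀ (norm_nonneg _) (hcoord i n ω) 2
  filter_upwards [ae_all_iff.2 h] with ω hω
  choose l hl using hω
  have hlim : Tendsto (fun n => ∑ k ∈ Finset.range (n + 1), c k • M k ω) atTop
      (𝓝 (WithLp.toLp 2 l)) := by
    have h1 := (PiLp.continuous_toLp 2 fun _ : Fin d => ℝ).tendsto l
    have h2 := h1.comp (tendsto_pi_nhds.2 hl)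
    refine h2.congr fun n => ?_
    ext i
    simp
  exact ((tendsto_add_atTop_iff_nat (f := fun n => ∑ k ∈ Finset.range n, c k • M k ω) 1).1
    hlim).cauchySeq

/-- Weights that are square summable times functions bounded in `L²` tend to `0`. -/
theorem ae_tendsto_smul_zero {E : Type*} [NormedAddCommGroup E] [NormedSpace ℝ E]
    {X : ℕ → Ω → E} (hX : ∀ n, AEStronglyMeasurable (X n) μ) {σ : ℝ}
    (hσ : ∀ n, ∫⁻ ω, ‖X n ω‖ₑ ^ 2 ∂μ ≤ ENNReal.ofReal (σ ^ 2)) {c : ℕ → ℝ}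
    (hc : Summable fun n => c n ^ 2) :
    ∀ᵐ ω ∂μ, Tendsto (fun n => c n • X n ω) atTop (𝓝 0) := by
  have hmeas : ∀ n, AEMeasurable (fun ω => ‖c n • X n ω‖ₑ ^ 2) μ := fun n =>
    ((hX n).const_smul (c n)).enorm.pow_const 2
  have hle : ∀ n, ∫⁻ ω, ‖c n • X n ω‖ₑ ^ 2 ∂μ ≤ ENNReal.ofReal (c n ^ 2 * σ ^ 2) := fun n => by
    have e : ∀ ω, ‖c n • X n ω‖ₑ ^ 2 = ENNReal.ofReal (c n ^ 2) * ‖X n ω‖ₑ ^ 2 := fun ω => by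
      rw [enorm_smul, mul_pow, Real.enorm_eq_ofReal_abs, ← ENNReal.ofReal_pow (abs_nonneg _),
        sq_abs]
    simp_rw [e]
    rw [lintegral_const_mul'' _ ((hX n).enorm.pow_const 2), ENNReal.ofReal_mul (sq_nonneg _)]
    exact mul_le_mul_right (hσ n) _
  -- By Tonelli the series of squares has finite expectation, so almost surely it converges and its
  -- terms vanish. No martingale property is needed.
  have hsum : ∫⁻ ω, ∑' n, ‖c n • X n ω‖ₑ ^ 2 ∂μ ≠ ∞ := by
    rw [lintegral_tsum hmeas]
    refine ne_top_of_le_ne_top ?_ (ENNReal.tsum_le_tsum hle)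
    rw [← ENNReal.ofReal_tsum_of_nonneg (fun n => by positivity) (hc.mul_right _)]
    exact ENNReal.ofReal_ne_top
  filter_upwards [ae_lt_top' (AEMeasurable.tsum hmeas) hsum] with ω hω
  have h1 := ENNReal.tendsto_atTop_zero_of_tsum_ne_top hω.ne
  have h2 := (ENNReal.tendsto_toReal ENNReal.zero_ne_top).comp h1
  have h3 := (Real.continuous_sqrt.tendsto _).comp h2
  rw [tendsto_zero_iff_norm_tendsto_zero]
  simpa [Function.comp_def, Real.sqrt_sq] using h3

end Noise

/-! ### The iterates of the algorithm -/

namespace FedGAN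

variable {B dW dΘ : ℕ} {Ξ : Type*} [MeasurableSpace Ξ] (A : FedGAN B dW dΘ Ξ)

theorem average_const {E : Type*} [AddCommGroup E] [Module ℝ E] (x : E) :
    (A.average fun _ => x) = x := by
  rw [average, ← Finset.sum_smul, A.p_sum, one_smul]

theorem average_add {E : Type*} [AddCommGroup E] [Module ℝ E] (x y : Fin B → E) :
    (A.average fun i => x i + y i) = A.average x + A.average y := by
  simp [average, smul_add, Finset.sum_add_distrib]

theorem average_sub {E : Type*} [AddCommGroup E] [Module ℝ E] (x y : Fin B → E) :
    (A.average fun i => x i - y i) = A.average x - A.average y := by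
  simp [average, smul_sub, Finset.sum_sub_distrib]

theorem average_smul {E : Type*} [AddCommGroup E] [Module ℝ E] (c : ℝ) (x : Fin B → E) :
    (A.average fun i => c • x i) = c • A.average x := by
  simp [average, Finset.smul_sum, smul_comm c]

theorem average_fst {E F : Type*} [AddCommGroup E] [Module ℝ E] [AddCommGroup F] [Module ℝ F]
    (x : Fin B → E × F) : (A.average x).1 = A.average fun i => (x i).1 := by
  simp [average, Prod.fst_sum]

theorem average_snd {E F : Type*} [AddCommGroup E] [Module ℝ E] [AddCommGroup F] [Module ℝ F]
    (x : Fin B → E × F) : (A.average x).2 = A.average fun i => (x i).2 := by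
  simp [average, Prod.snd_sum]

theorem tendsto_average_zero {E ι : Type*} [NormedAddCommGroup E] [NormedSpace ℝ E] {l : Filter ι}
    {x : ι → Fin B → E} (h : ∀ i, Tendsto (fun n => x n i) l (𝓝 0)) :
    Tendsto (fun n => A.average (x n)) l (𝓝 0) := by
  have := tendsto_finsetSum (Finset.univ : Finset (Fin B)) fun i _ => (h i).const_smul (A.p i)
  simpa [average] using this

theorem norm_average_le {E : Type*} [NormedAddCommGroup E] [NormedSpace ℝ E] (x : Fin B → E) :
    ‖A.average x‖ ≤ ∑ i, A.p i * ‖x i‖ := by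
  refine (norm_sum_le _ _).trans (le_of_eq (Finset.sum_congr rfl fun i _ => ?_))
  rw [norm_smul, Real.norm_of_nonneg (A.p_nonneg i)]

/-- Convexity of the square transfers the variance bounds of the agents to the aggregated noise. -/
theorem enorm_average_sq_le {E : Type*} [NormedAddCommGroup E] [NormedSpace ℝ E] (x : Fin B → E) :
    ‖A.average x‖ₑ ^ 2 ≤ ∑ i, ENNReal.ofReal (A.p i) * ‖x i‖ₑ ^ 2 := by
  have h1 : ‖A.average x‖ ^ 2 ≤ ∑ i, A.p i * ‖x i‖ ^ 2 :=
    (pow_le_pow_left₀ (norm_nonneg _) (A.norm_average_le x) 2).trans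
      (Real.pow_arith_mean_le_arith_mean_pow _ _ _ (fun i _ => A.p_nonneg i) A.p_sum
        (fun i _ => norm_nonneg _) 2)
  have h2 := ENNReal.ofReal_le_ofReal h1
  rw [ENNReal.ofReal_pow (norm_nonneg _), ofReal_norm,
    ENNReal.ofReal_sum_of_nonneg fun i _ => mul_nonneg (A.p_nonneg i) (sq_nonneg _)] at h2
  refine h2.trans (le_of_eq (Finset.sum_congr rfl fun i _ => ?_))
  rw [ENNReal.ofReal_mul (A.p_nonneg i), ENNReal.ofReal_pow (norm_nonneg _), ofReal_norm]

theorem lintegral_enorm_average_sq_le {E Ω : Type*} [MeasurableSpace Ω] {μ : Measure Ω}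
    [NormedAddCommGroup E] [NormedSpace ℝ E] {x : Fin B → Ω → E}
    (hx : ∀ i, AEStronglyMeasurable (x i) μ) {c : ℝ≥0∞}
    (hc : ∀ i, ∫⁻ ω, ‖x i ω‖ₑ ^ 2 ∂μ ≤ c) :
    ∫⁻ ω, ‖A.average fun i => x i ω‖ₑ ^ 2 ∂μ ≤ c := by
  have hm : ∀ i, AEMeasurable (fun ω => ‖x i ω‖ₑ ^ 2) μ := fun i => (hx i).enorm.pow_const 2
  calc _ ≤ ∫⁻ ω, ∑ i, ENNReal.ofReal (A.p i) * ‖x i ω‖ₑ ^ 2 ∂μ :=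
        lintegral_mono fun ω => A.enorm_average_sq_le _
    _ = ∑ i, ENNReal.ofReal (A.p i) * ∫⁻ ω, ‖x i ω‖ₑ ^ 2 ∂μ := by
        rw [lintegral_finsetSum' _ fun i _ => (hm i).const_mul _]
        exact Finset.sum_congr rfl fun i _ => lintegral_const_mul'' _ (hm i)
    _ ≤ ∑ i, ENNReal.ofReal (A.p i) * c :=
        Finset.sum_le_sum fun i _ => mul_le_mul_right (hc i) _
    _ = c := by
        rw [← Finset.sum_mul, ← ENNReal.ofReal_sum_of_nonneg fun i _ => A.p_nonneg i, A.p_sum]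
        simp

theorem lipschitzWith_pooled {d : ℕ} {f : Fin B → Vec dΘ × Vec dW → Vec d} {L : ℝ≥0}
    (hf : ∀ i, LipschitzWith L (f i)) : LipschitzWith L (A.pooled f) := by
  refine LipschitzWith.of_dist_le_mul fun z z' => ?_
  rw [dist_eq_norm, pooled, pooled, ← average_sub]
  refine (A.norm_average_le _).trans ?_
  calc _ ≤ ∑ i, A.p i * (L * dist z z') := by
        refine Finset.sum_le_sum fun i _ => mul_le_mul_of_nonneg_left ?_ (A.p_nonneg i)
        rw [← dist_eq_norm]
        exact (hf i).dist_le_mul _ _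
    _ = _ := by rw [← Finset.sum_mul, A.p_sum, one_mul]

section Iterates

variable (s : ℕ → Fin B → Ξ)

theorem averaged_succ (n : ℕ) :
    A.averaged s (n + 1) = A.average fun i => A.localUpdate n i (A.agent s n i) (s n i) := by
  by_cases h : (n + 1) % A.K = 0
  · simp only [averaged, agent, h, if_true]
    exact A.average_const _
  · simp only [averaged, agent, h, if_false]

theorem agent_eq_averaged {n : ℕ} (h : n % A.K = 0) (i : Fin B) :
    A.agent s n i = A.averaged s n := by
  cases n with
  | zero => exact (A.average_const _).symm
  | succ n => rw [averaged_succ]; simp only [agent, h, if_true]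

end Iterates

variable {Ω : Type*} (g : Fin B → Vec dΘ × Vec dW → Vec dW) (h : Fin B → Vec dΘ × Vec dW → Vec dΘ)
  (ξ : ℕ → Fin B → Ω → Ξ) (ω : Ω)

theorem localUpdate_eq (n : ℕ) (i : Fin B) :
    A.localUpdate n i (A.agent (fun m j => ξ m j ω) n i) (ξ n i ω) =
      A.agent (fun m j => ξ m j ω) n i +
        (A.b n • (h i (A.agent (fun m j => ξ m j ω) n i) - A.errorΘ h ξ n i ω),
          A.a n • (g i (A.agent (fun m j => ξ m j ω) n i) - A.errorW g ξ n i ω)) := by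
  simp [localUpdate, errorΘ, errorW, Prod.ext_iff]

/-- The average of the gradients of the agents at their own parameters, less the pooled gradient at
the averaged parameters. -/
def drift {d : ℕ} (f : Fin B → Vec dΘ × Vec dW → Vec d) (s : ℕ → Fin B → Ξ) (n : ℕ) : Vec d :=
  A.average fun i => f i (A.agent s n i) - f i (A.averaged s n)

theorem averaged_succ_fst (n : ℕ) :
    (A.averaged (fun m j => ξ m j ω) (n + 1)).1 = (A.averaged (fun m j => ξ m j ω) n).1 +
      A.b n • (A.pooled h (A.averaged (fun m j => ξ m j ω) n) + A.drift h (fun m j => ξ m j ω) n) -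
      A.b n • A.noiseΘ h ξ n ω := by
  rw [averaged_succ, average_fst]
  simp only [localUpdate, errorΘ, average_add, average_smul, average_sub, drift, noiseΘ, pooled]
  rw [averaged, average_fst, add_sub_cancel, smul_sub]
  abel

theorem averaged_succ_snd (n : ℕ) :
    (A.averaged (fun m j => ξ m j ω) (n + 1)).2 = (A.averaged (fun m j => ξ m j ω) n).2 +
      A.a n • (A.pooled g (A.averaged (fun m j => ξ m j ω) n) + A.drift g (fun m j => ξ m j ω) n) -
      A.a n • A.noiseW g ξ n ω := by
  rw [averaged_succ, average_snd]
  simp only [localUpdate, errorW, average_add, average_smul, average_sub, drift, noiseW, pooled]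
  rw [averaged, average_snd, add_sub_cancel, smul_sub]
  abel

/-- Gradients need not be bounded, but a Lipschitz map grows at most linearly and `x` stays
asymptotically close to the bounded `y`. -/
theorem _root_.LipschitzWith.tendsto_smul_zero {E F ι : Type*} [NormedAddCommGroup E]
    [NormedAddCommGroup F] [NormedSpace ℝ F] {f : E → F} {L : ℝ≥0} (hf : LipschitzWith L f)
    {l : Filter ι} {c : ι → ℝ} (hc : Tendsto c l (𝓝 0)) {x y : ι → E} {R : ℝ}
    (hy : ∀ n, ‖y n‖ ≤ R) (hxy : Tendsto (fun n => x n - y n) l (𝓝 0)) :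
    Tendsto (fun n => c n • f (x n)) l (𝓝 0) := by
  have h1 : Tendsto (fun n => |c n| * (‖f 0‖ + L * (‖x n - y n‖ + R))) l (𝓝 0) := by
    have := hc.abs.mul (((tendsto_zero_iff_norm_tendsto_zero.1 hxy).add_const R).const_mul
      (L : ℝ) |>.const_add ‖f 0‖)
    simpa using this
  refine squeeze_zero_norm (fun n => ?_) h1
  rw [norm_smul, Real.norm_eq_abs]
  refine mul_le_mul_of_nonneg_left ?_ (abs_nonneg _)
  have h2 : ‖f (x n) - f 0‖ ≤ L * ‖x n - 0‖ := hf.norm_sub_le _ _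
  rw [sub_zero] at h2
  have h3 : ‖x n‖ ≤ ‖x n - y n‖ + R := by
    have := norm_add_le (x n - y n) (y n)
    rw [sub_add_cancel] at this
    linarith [hy n]
  have h4 := mul_le_mul_of_nonneg_left h3 L.2
  simp only [NNReal.val_eq_coe] at h4
  have h5 := norm_add_le (f (x n) - f 0) (f 0)
  rw [sub_add_cancel] at h5
  linarith

theorem tendsto_agent_sub_averaged {g h} {L : ℝ≥0} (hgL : ∀ i, LipschitzWith L (g i))
    (hhL : ∀ i, LipschitzWith L (h i)) (ha : Tendsto A.a atTop (𝓝 0))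
    (hb : Tendsto A.b atTop (𝓝 0)) {ω : Ω}
    (heW : ∀ i, Tendsto (fun n => A.a n • A.errorW g ξ n i ω) atTop (𝓝 0))
    (heΘ : ∀ i, Tendsto (fun n => A.b n • A.errorΘ h ξ n i ω) atTop (𝓝 0)) {R : ℝ}
    (hR : ∀ n, ‖A.averaged (fun m j => ξ m j ω) n‖ ≤ R) (i : Fin B) :
    Tendsto (fun n => A.agent (fun m j => ξ m j ω) n i - A.averaged (fun m j => ξ m j ω) n)
      atTop (𝓝 0) := by
  set s : ℕ → Fin B → Ξ := fun m j => ξ m j ω with hs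
  have hK := A.K_pos
  have hidx : ∀ j, Tendsto (fun k => k * A.K + j) atTop atTop := fun j =>
    tendsto_atTop_mono (fun k => (Nat.le_mul_of_pos_right k hK).trans (Nat.le_add_right _ j))
      tendsto_id
  -- The reference point is the last synchronized value, fixed while the offset `j` grows. Each of
  -- the fewer than `K` steps adds a vanishing term.
  have key : ∀ j < A.K, ∀ i, Tendsto (fun k => A.agent s (k * A.K + j) i - A.averaged s (k * A.K))
      atTop (𝓝 0) := by
    intro j
    induction j with
    | zero =>
      intro _ i
      refine tendsto_const_nhds.congr fun k => ?_
      rw [add_zero, A.agent_eq_averaged s (Nat.mul_mod_left k A.K), sub_self]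
    | succ j ih =>
      intro hj i
      have ih := ih (by omega) i
      have h1 := (hhL i).tendsto_smul_zero (hb.comp (hidx j)) (fun k => hR (k * A.K)) ih
      have h2 := (hgL i).tendsto_smul_zero (ha.comp (hidx j)) (fun k => hR (k * A.K)) ih
      have h3 := (h1.sub ((heΘ i).comp (hidx j))).prodMk_nhds
        (h2.sub ((heW i).comp (hidx j)))
      have h4 := ih.add h3
      rw [sub_zero, sub_zero, Prod.mk_zero_zero, add_zero] at h4
      refine h4.congr fun k => ?_
      have hmod : ¬ (k * A.K + j + 1) % A.K = 0 := by
        rw [add_assoc, Nat.mul_add_mod', Nat.mod_eq_of_lt hj]; omega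
      rw [← add_assoc]
      simp only [agent, hmod, if_false]
      rw [hs, A.localUpdate_eq g h]
      simp only [Function.comp, smul_sub]
      abel
  -- The current average differs from the synchronized value by the average of the deviations in
  -- `key`, so it can replace that value.
  have key2 : ∀ j < A.K, Tendsto (fun k => A.agent s (k * A.K + j) i -
      A.averaged s (k * A.K + j)) atTop (𝓝 0) := by
    intro j hj
    have h1 := (key j hj i).sub (A.tendsto_average_zero (key j hj))
    rw [sub_zero] at h1
    refine h1.congr fun k => ?_
    rw [average_sub, average_const, averaged]
    abel
  refine Metric.tendsto_nhds.2 fun ε hε => ?_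
  have h1 : ∀ᶠ k in atTop, ∀ j ∈ Finset.range A.K, dist (A.agent s (k * A.K + j) i -
      A.averaged s (k * A.K + j)) 0 < ε :=
    (Filter.eventually_all_finset _).2 fun j hj =>
      Metric.tendsto_nhds.1 (key2 j (Finset.mem_range.1 hj)) ε hε
  filter_upwards [(Nat.tendsto_div_const_atTop hK.ne').eventually h1] with n hn
  have := hn (n % A.K) (Finset.mem_range.2 (Nat.mod_lt n hK))
  rwa [Nat.div_add_mod'] at this

theorem tendsto_drift {d : ℕ} {f : Fin B → Vec dΘ × Vec dW → Vec d} {L : ℝ≥0}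
    (hf : ∀ i, LipschitzWith L (f i)) {s : ℕ → Fin B → Ξ}
    (hs : ∀ i, Tendsto (fun n => A.agent s n i - A.averaged s n) atTop (𝓝 0)) :
    Tendsto (A.drift f s) atTop (𝓝 0) := by
  refine A.tendsto_average_zero fun i => squeeze_zero_norm
    (fun n => (hf i).norm_sub_le _ _) ?_
  simpa using (tendsto_zero_iff_norm_tendsto_zero.1 (hs i)).const_mul (L : ℝ)

section Measurability

variable [MeasurableSpace Ω] {ξ}

theorem measurable_average {E : Type*} [NormedAddCommGroup E] [NormedSpace ℝ E]
    [MeasurableSpace E] [BorelSpace E] [SecondCountableTopology E] {x : Fin B → Ω → E}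
    (hx : ∀ i, Measurable (x i)) : Measurable fun ω => A.average fun i => x i ω :=
  Finset.measurable_fun_sum _ fun i _ => (hx i).const_smul (A.p i)

theorem measurable_agent (hξ : ∀ n i, Measurable (ξ n i)) (n : ℕ) (i : Fin B) :
    Measurable fun ω => A.agent (fun m j => ξ m j ω) n i := by
  induction n generalizing i with
  | zero => exact measurable_const
  | succ n ih =>
    have hloc : ∀ i, Measurable fun ω =>
        A.localUpdate n i (A.agent (fun m j => ξ m j ω) n i) (ξ n i ω) := fun i => by
      have h1 := (A.hTilde_measurable i).comp ((ih i).prodMk (hξ n i))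
      have h2 := (A.gTilde_measurable i).comp ((ih i).prodMk (hξ n i))
      exact ((ih i).fst.add (h1.const_smul (A.b n))).prodMk
        ((ih i).snd.add (h2.const_smul (A.a n)))
    by_cases hn : (n + 1) % A.K = 0
    · simp only [agent, hn, if_true]
      exact A.measurable_average hloc
    · simp only [agent, hn, if_false]
      exact hloc i

variable {g h}

theorem measurable_errorW (hξ : ∀ n i, Measurable (ξ n i)) (hg : ∀ i, Measurable (g i)) (n : ℕ)
    (i : Fin B) : Measurable (A.errorW g ξ n i) :=
  ((hg i).comp (A.measurable_agent hξ n i)).sub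
    ((A.gTilde_measurable i).comp ((A.measurable_agent hξ n i).prodMk (hξ n i)))

theorem measurable_errorΘ (hξ : ∀ n i, Measurable (ξ n i)) (hh : ∀ i, Measurable (h i)) (n : ℕ)
    (i : Fin B) : Measurable (A.errorΘ h ξ n i) :=
  ((hh i).comp (A.measurable_agent hξ n i)).sub
    ((A.hTilde_measurable i).comp ((A.measurable_agent hξ n i).prodMk (hξ n i)))

/-- The histories as a filtration. -/
def historyFiltration (hξ : ∀ n i, Measurable (ξ n i)) (hg : ∀ i, Measurable (g i))
    (hh : ∀ i, Measurable (h i)) : Filtration ℕ (inferInstance : MeasurableSpace Ω) where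
  seq := A.history g h ξ
  mono' _ _ hmn := biSup_mono fun _ hl => hl.trans hmn
  le' _ := iSup₂_le fun l _ => Measurable.comap_le <|
    (A.measurable_average (A.measurable_agent hξ l)).prodMk
      ((A.measurable_average (A.measurable_errorΘ hξ hh l)).prodMk
        (A.measurable_average (A.measurable_errorW hξ hg l)))

end Measurability

end FedGAN

/-! ### Convergence on two time scales -/

/-- The deterministic half of the argument: noise enters only through the Cauchy sequences `U` and
`U'`. -/
theorem tendsto_of_two_time_scales {P W : Type*} [NormedAddCommGroup P] [NormedSpace ℝ P]
    [NormedAddCommGroup W] [NormedSpace ℝ W] {G : P × W → W} {H : P × W → P} {L : ℝ≥0}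
    (hG : LipschitzWith L G) (hH : LipschitzWith L H) {lam : P → W} {Llam : ℝ≥0}
    (hlamL : LipschitzWith Llam lam)
    (hlam : ∀ p, IsLocallyAsymptoticallyStable (fun w => G (p, w)) (lam p)) {e : P}
    (he : IsLocallyAsymptoticallyStable (fun p => H (p, lam p)) e) {C : Set (P × W)}
    (hC : IsCompact C) (hCd : ∀ z ∈ C, z.1 ∈ domainOfAttraction (fun p => H (p, lam p)) e ∧
      z.2 ∈ domainOfAttraction (fun w => G (z.1, w)) (lam z.1)) {a b : ℕ → ℝ} (ha : ∀ n, 0 < a n)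
    (hb : ∀ n, 0 ≤ b n) (ha0 : Tendsto a atTop (𝓝 0)) (hb0 : Tendsto b atTop (𝓝 0))
    (hasum : Tendsto (fun N => ∑ n ∈ Finset.range N, a n) atTop atTop)
    (hbsum : Tendsto (fun N => ∑ n ∈ Finset.range N, b n) atTop atTop) (hab : b =o[atTop] a)
    {z : ℕ → P × W} {r U : ℕ → P} {r' U' : ℕ → W}
    (hz : ∀ n, (z (n + 1)).1 = (z n).1 + b n • (H (z n) + r n) + (U (n + 1) - U n))
    (hz' : ∀ n, (z (n + 1)).2 = (z n).2 + a n • (G (z n) + r' n) + (U' (n + 1) - U' n))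
    (hr : Tendsto r atTop (𝓝 0)) (hr' : Tendsto r' atTop (𝓝 0)) (hU : CauchySeq U)
    (hU' : CauchySeq U') (hmem : ∀ᶠ n in atTop, z n ∈ C) :
    Tendsto z atTop (𝓝 (e, lam e)) := by
  -- Measured in the fast clock, the slow variable has velocity `b n / a n` times a quantity that is
  -- eventually bounded, since `z n` stays in `C`.
  have hq : Tendsto (fun n => (b n / a n) • (H (z n) + r n)) atTop (𝓝 0) := by
    obtain ⟨D, hD⟩ := hC.exists_bound_of_continuousOn hH.continuous.continuousOn
    have h1 : Tendsto (fun n => ‖b n / a n‖ * (D + ‖r n‖)) atTop (𝓝 0) := by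
      have := hab.tendsto_div_nhds_zero.norm.mul
        ((tendsto_zero_iff_norm_tendsto_zero.1 hr).const_add D)
      simpa using this
    refine squeeze_zero_norm' ?_ h1
    filter_upwards [hmem] with n hn
    rw [norm_smul]
    gcongr
    exact (norm_add_le _ _).trans (by linarith [hD _ hn])
  have hfast : Tendsto (fun n => (z n).2 - lam (z n).1) atTop (𝓝 0) := by
    refine tendsto_sub_equilibrium (F := fun p w => G (p, w)) (L := L)
      (fun p => LipschitzWith.of_dist_le_mul fun w w' => ?_)
      (fun w => LipschitzWith.of_dist_le_mul fun p p' => ?_) hlamL.continuous hlam hC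
      (fun z hz => (hCd z hz).2) (fun n => (ha n).le) ha0 hasum hz'
      (q := fun n => (b n / a n) • (H (z n) + r n)) (fun n => ?_) hr' hq hU' hU hmem
    · simpa [Prod.dist_eq] using hG.dist_le_mul (p, w) (p, w')
    · simpa [Prod.dist_eq] using hG.dist_le_mul (p, w) (p', w)
    · rw [hz, smul_smul, mul_div_cancel₀ _ (ha n).ne']
  have hHlam : LipschitzWith (L * max 1 Llam) fun p => H (p, lam p) :=
    hH.comp (LipschitzWith.id.prodMk hlamL)
  have hslow : Tendsto (fun n => (z n).1 - e) atTop (𝓝 0) := by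
    have hdiff : Tendsto (fun n => H (z n) - H ((z n).1, lam (z n).1)) atTop (𝓝 0) := by
      refine squeeze_zero_norm (fun n => hH.norm_sub_le _ _) ?_
      have : ∀ n, ‖z n - ((z n).1, lam (z n).1)‖ = ‖(z n).2 - lam (z n).1‖ := fun n => by
        simp [Prod.norm_def]
      simp_rw [this]
      simpa using (tendsto_zero_iff_norm_tendsto_zero.1 hfast).const_mul (L : ℝ)
    -- The slow equation is autonomous, so the parameter space is a point. Replacing `w` by `lam θ`
    -- is absorbed into the perturbation `r`.
    refine tendsto_sub_equilibrium (P := Unit) (F := fun _ p => H (p, lam p))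
      (e := fun _ => e) (C := (fun z => ((), z.1)) '' C)
      (r := fun n => (H (z n) - H ((z n).1, lam (z n).1)) + r n) (q := fun _ => 0)
      (V := fun _ => 0) (p := fun _ => ()) (U := U) (a := b)
      (fun _ => hHlam) (fun p => LipschitzWith.of_dist_le_mul fun _ _ => by simp)
      continuous_const (fun _ => he) (hC.image (by fun_prop)) ?_ hb hb0 hbsum
      (fun n => by rw [hz]; congr 3; abel) (fun n => Subsingleton.elim _ _)
      (by simpa using hdiff.add hr) tendsto_const_nhds hU (cauchySeq_const _) ?_
    · rintro _ ⟨z, hz, rfl⟩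
      exact (hCd z hz).1
    · filter_upwards [hmem] with n hn using ⟨_, hn, rfl⟩
  have h1 : Tendsto (fun n => (z n).1) atTop (𝓝 e) := by
    simpa using hslow.add_const e
  have h2 : Tendsto (fun n => (z n).2) atTop (𝓝 (lam e)) := by
    simpa using hfast.add ((hlamL.continuous.tendsto e).comp h1)
  exact h1.prodMk_nhds h2

theorem mainTheorem3 {B dW dΘ : ℕ} {Ξ Ω : Type*} [MeasurableSpace Ξ] [MeasurableSpace Ω]
    (μ : Measure Ω) [IsProbabilityMeasure μ]
    (A : FedGAN B dW dΘ Ξ)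
    -- the mini-batches, and the true gradients of the agents
    (ξ : ℕ → Fin B → Ω → Ξ) (hξ : ∀ n i, Measurable (ξ n i))
    (g : Fin B → Vec dΘ × Vec dW → Vec dW) (h : Fin B → Vec dΘ × Vec dW → Vec dΘ)
    -- (A1)
    (L : ℝ≥0) (hgL : ∀ i, LipschitzWith L (g i)) (hhL : ∀ i, LipschitzWith L (h i))
    -- (A2)
    (ha : Tendsto (fun N => ∑ n ∈ Finset.range N, A.a n) atTop atTop)
    (ha2 : Summable fun n => A.a n ^ 2)
    (hb : Tendsto (fun N => ∑ n ∈ Finset.range N, A.b n) atTop atTop)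
    (hb2 : Summable fun n => A.b n ^ 2)
    -- (A3)
    (hMΘ : IsMartingaleDifference (A.noiseΘ h ξ) (A.history g h ξ) μ)
    (hMW : IsMartingaleDifference (A.noiseW g ξ) (A.history g h ξ) μ)
    -- (A4)
    (hbdd : ∀ᵐ ω ∂μ, ∃ R : ℝ, ∀ n, ‖A.averaged (fun m j => ξ m j ω) n‖ ≤ R)
    -- (A5)
    (σg σh μg : ℝ)
    (hσg : ∀ n i, ∫⁻ ω, ‖A.errorW g ξ n i ω‖ₑ ^ 2 ∂μ ≤ ENNReal.ofReal (σg ^ 2))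
    (hσh : ∀ n i, ∫⁻ ω, ‖A.errorΘ h ξ n i ω‖ₑ ^ 2 ∂μ ≤ ENNReal.ofReal (σh ^ 2))
    (hμg : ∀ i z, ‖g i z - A.pooled g z‖ ≤ μg)
    -- (A6)
    (hab : A.b =o[atTop] A.a)
    -- (A7)
    (lam : Vec dΘ → Vec dW) (Llam : ℝ≥0) (hlamL : LipschitzWith Llam lam)
    (hlam : ∀ θ, IsLocallyAsymptoticallyStable (fun w => A.pooled g (θ, w)) (lam θ))
    (θstar : Vec dΘ)
    (hθstar : IsLocallyAsymptoticallyStable (fun θ => A.pooled h (θ, lam θ)) θstar) :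
    -- almost surely on the event that the averaged iterates eventually stay in a compact subset of
    -- the region of attraction
    ∀ᵐ ω ∂μ,
      (∃ C : Set (Vec dΘ × Vec dW), IsCompact C ∧
        (∀ z ∈ C, z.1 ∈ domainOfAttraction (fun θ => A.pooled h (θ, lam θ)) θstar ∧
          z.2 ∈ domainOfAttraction (fun w => A.pooled g (z.1, w)) (lam z.1)) ∧
        ∀ᶠ n in atTop, A.averaged (fun m j => ξ m j ω) n ∈ C) →
      Tendsto (fun n => A.averaged (fun m j => ξ m j ω) n) atTop (𝓝 (θstar, lam θstar)) := by
  have ha0 : Tendsto A.a atTop (𝓝 0) := by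
    have := (Real.continuous_sqrt.tendsto _).comp ha2.tendsto_atTop_zero
    simpa [Function.comp_def, Real.sqrt_sq (A.a_pos _).le] using this
  have hb0 : Tendsto A.b atTop (𝓝 0) := by
    have := (Real.continuous_sqrt.tendsto _).comp hb2.tendsto_atTop_zero
    simpa [Function.comp_def, Real.sqrt_sq (A.b_pos _).le] using this
  have hgm : ∀ i, Measurable (g i) := fun i => (hgL i).continuous.measurable
  have hhm : ∀ i, Measurable (h i) := fun i => (hhL i).continuous.measurable
  have heW := fun n i => (A.measurable_errorW hξ hgm n i).aestronglyMeasurable (μ := μ)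
  have heΘ := fun n i => (A.measurable_errorΘ hξ hhm n i).aestronglyMeasurable (μ := μ)
  -- The errors of single agents need not be martingale differences. The variance bound alone makes
  -- their steps vanish, which is all that the consensus of the agents requires.
  have hW0 : ∀ᵐ ω ∂μ, ∀ i, Tendsto (fun n => A.a n • A.errorW g ξ n i ω) atTop (𝓝 0) :=
    ae_all_iff.2 fun i => ae_tendsto_smul_zero (fun n => heW n i) (fun n => hσg n i) ha2
  have hΘ0 : ∀ᵐ ω ∂μ, ∀ i, Tendsto (fun n => A.b n • A.errorΘ h ξ n i ω) atTop (𝓝 0) :=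
    ae_all_iff.2 fun i => ae_tendsto_smul_zero (fun n => heΘ n i) (fun n => hσh n i) hb2
  have hMW' := IsMartingaleDifference.ae_cauchySeq_sum_smul
    (ℱ := A.historyFiltration hξ hgm hhm) hMW
    (fun n => A.lintegral_enorm_average_sq_le (heW n) (hσg n)) ha2
  have hMΘ' := IsMartingaleDifference.ae_cauchySeq_sum_smul
    (ℱ := A.historyFiltration hξ hgm hhm) hMΘ
    (fun n => A.lintegral_enorm_average_sq_le (heΘ n) (hσh n)) hb2
  filter_upwards [hbdd, hW0, hΘ0, hMW', hMΘ'] with ω ⟨R, hR⟩ hW hΘ hcW hcΘ ⟨C, hC, hCd, hmem⟩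
  have hsub := A.tendsto_agent_sub_averaged ξ hgL hhL ha0 hb0 hW hΘ hR
  refine tendsto_of_two_time_scales (A.lipschitzWith_pooled hgL) (A.lipschitzWith_pooled hhL) hlamL
    hlam hθstar hC hCd A.a_pos (fun n => (A.b_pos n).le) ha0 hb0 ha hb hab
    -- The minus sign reflects that the errors are true gradient minus stochastic gradient.
    (U := fun n => -∑ k ∈ Finset.range n, A.b k • A.noiseΘ h ξ k ω)
    (U' := fun n => -∑ k ∈ Finset.range n, A.a k • A.noiseW g ξ k ω)
    (fun n => ?_) (fun n => ?_) (A.tendsto_drift hhL hsub) (A.tendsto_drift hgL hsub)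
    hcΘ.neg hcW.neg hmem
  · rw [A.averaged_succ_fst, Finset.sum_range_succ]; abel
  · rw [A.averaged_succ_snd, Finset.sum_range_succ]; abel
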